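/- Let $K$ be a field. For a locally finite partially ordered set $X$ (that is, every interval $\{z \mid x\le z\le y\}$ is finite), the incidence coalgebra $KX$ is the $K$-vector space with basis $\{e_{x,y} \mid x,y\in X,\ x\le y\}$, comultiplication $\Delta(e_{x,y})=\sum_{x\le z\le y} e_{x,z}\otimes e_{z,y}$ and counit $\epsilon(e_{x,y})=\delta_{x,y}$. For a coalgebra $C$ over $K$, let $C^*$ be the dual algebra (with the convolution product), and let $(C^*)^0$ be the finite dual of $C^*$, i.e. the space of all linear functionals $C^*\to K$ whose kernel contains a two-sided ideal of $C^*$ of finite codimension. The coalgebra $C$ is called coreflexive if the natural map $C\to (C^*)^0$, $c\mapsto (f\mapsto f(c))$, is an isomorphism (equivalently, bijective). Let $X$ and $Y$ be locally finite partially ordered sets, let $C$ be a subcoalgebra of $KX$ and $D$ a subcoalgebra of $KY$. If $C$ and $D$ are coreflexive, then the tensor product coalgebra $C\otimes D$ over $K$ is coreflexive. -/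

import Mathlib

open scoped TensorProduct

noncomputable section

universe u v

/-- The finite dual `A⁰` of a `K`-algebra `A`: the linear functionals on `A` whose kernel contains
a two-sided ideal of finite codimension. -/
def finiteDual (K : Type u) (A : Type v) [Field K] [Ring A] [Algebra K A] :
    Submodule K (Module.Dual K A) where
  carrier := {f | ∃ I : Ideal A, I.IsTwoSided ∧ Module.Finite K (A ⧸ I) ∧ ∀ a ∈ I, f a = 0}
  zero_mem' := ⟨⊤, inferInstance, inferInstance, fun _ _ => rfl⟩
  add_mem' := by
    rintro f g ⟨I, hI, hIf, hfI⟩ ⟨J, hJ, hJf, hgJ⟩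
    refine ⟨I ⊓ J, ⟨fun b ha => ⟨hI.mul_mem_of_left b ha.1, hJ.mul_mem_of_left b ha.2⟩⟩, ?_,
      fun a ha => by simp [hfI a ha.1, hgJ a ha.2]⟩
    let φ : A →ₗ[K] (A ⧸ I) × (A ⧸ J) :=
      ((Submodule.mkQ I).restrictScalars K).prod ((Submodule.mkQ J).restrictScalars K)
    have hker : LinearMap.ker φ = (I ⊓ J : Submodule A A).restrictScalars K := by
      ext a
      simp [φ]
    have h : Module.Finite K (A ⧸ LinearMap.ker φ) :=
      Module.Finite.equiv φ.quotKerEquivRange.symm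
    rw [hker] at h
    exact h
  smul_mem' := by
    rintro k f ⟨I, hI, hIf, hfI⟩
    exact ⟨I, hI, hIf, fun a ha => by simp [hfI a ha]⟩

section Coreflexive

variable (K : Type u) (C : Type v) [Field K] [AddCommMonoid C] [Module K C] [Coalgebra K C]

/-- The dual algebra `C^*` of a coalgebra `C`: all linear functionals on `C`, with the convolution
product `(f * g)(c) = ∑ f(c₁) g(c₂)` and the counit as identity element. -/
abbrev DualAlgebra : Type (max u v) := WithConv (C →ₗ[K] K)

/-- Evaluation at elements of `C`, as a linear map `C → (C^*)^*`. -/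
def evalDual : C →ₗ[K] Module.Dual K (DualAlgebra K C) where
  toFun c :=
    { toFun := fun f => f c
      map_add' := fun _ _ => rfl
      map_smul' := fun _ _ => rfl }
  map_add' c d := LinearMap.ext fun f => f.ofConv.map_add c d
  map_smul' k c := LinearMap.ext fun f => f.ofConv.map_smul k c

theorem evalDual_mem_finiteDual (c : C) : evalDual K C c ∈ finiteDual K (DualAlgebra K C) := by
  classical
  let I : Ideal (DualAlgebra K C) :=
    { carrier := {f | ∀ a b : DualAlgebra K C, (a * f * b) c = 0}
      zero_mem' := fun a b => by simp
      add_mem' := fun {f g} hf hg a b => by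
        have := congrArg₂ (· + ·) (hf a b) (hg a b)
        rw [mul_add, add_mul]
        simpa using this
      smul_mem' := fun r f hf a b => by
        rw [smul_eq_mul, ← mul_assoc]
        exact hf (a * r) b }
  have hmem : ∀ f, f ∈ I ↔ ∀ a b : DualAlgebra K C, (a * f * b) c = 0 := fun _ => Iff.rfl
  refine ⟨I, ⟨fun {f} r hf => ?_⟩, ?_, fun f hf => ?_⟩
  · rw [hmem] at hf ⊢
    intro a b
    rw [← mul_assoc, mul_assoc _ r b]
    exact hf a (r * b)
  · let R := Coalgebra.Repr.arbitrary K c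
    let R' := fun i => Coalgebra.Repr.arbitrary K (R.left i)
    let T : Finset C := R.index.biUnion fun i => (R' i).index.image (R' i).right
    let φ : DualAlgebra K C →ₗ[K] (T → K) := LinearMap.pi fun t => evalDual K C t
    have hker : LinearMap.ker φ ≤ I.restrictScalars K := by
      intro f hf
      have hT : ∀ t ∈ T, f t = 0 := fun t ht => congrFun (LinearMap.mem_ker.mp hf) ⟨t, ht⟩
      change f ∈ I
      rw [hmem]
      intro a b
      rw [R.convMul_apply]
      refine Finset.sum_eq_zero fun i hi => ?_
      rw [(R' i).convMul_apply, Finset.sum_eq_zero, zero_mul]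
      intro j hj
      rw [hT _ (Finset.mem_biUnion.mpr ⟨i, hi, Finset.mem_image_of_mem _ hj⟩), mul_zero]
    have hfin : Module.Finite K (DualAlgebra K C ⧸ LinearMap.ker φ) :=
      Module.Finite.equiv φ.quotKerEquivRange.symm
    have hfin' : Module.Finite K (DualAlgebra K C ⧸ I.restrictScalars K) :=
      Module.Finite.of_surjective (Submodule.factor hker) (Submodule.factor_surjective hker)
    exact hfin'
  · have := (hmem f).mp hf 1 1
    rwa [one_mul, mul_one] at this

/-- The natural map `C → (C^*)⁰`, `c ↦ (f ↦ f c)`. -/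
def toFiniteDual : C →ₗ[K] finiteDual K (DualAlgebra K C) :=
  (evalDual K C).codRestrict _ (evalDual_mem_finiteDual K C)

/-- `C` is coreflexive if the natural map `C → (C^*)⁰` is an isomorphism. -/
def IsCoreflexive : Prop := Function.Bijective (toFiniteDual K C)

end Coreflexive

section Subcoalgebra

/-- A subcoalgebra of `C`: a subspace `N` with `Δ(N) ⊆ N ⊗ N`. -/
structure Subcoalgebra (K : Type u) (C : Type v) [Field K] [AddCommGroup C] [Module K C]
    [Coalgebra K C] extends Submodule K C where
  comul_mem' : ∀ c ∈ toSubmodule, Coalgebra.comul (R := K) c ∈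
    LinearMap.range (TensorProduct.map toSubmodule.subtype toSubmodule.subtype)

variable {K : Type u} {C : Type v} [Field K] [AddCommGroup C] [Module K C] [Coalgebra K C]

namespace Subcoalgebra

/-- The underlying vector space of a subcoalgebra. -/
instance : CoeSort (Subcoalgebra K C) (Type v) := ⟨fun N => N.toSubmodule⟩

theorem map_subtype_injective (N : Subcoalgebra K C) :
    Function.Injective (TensorProduct.map N.toSubmodule.subtype N.toSubmodule.subtype) :=
  TensorProduct.map_injective_of_flat_flat _ _ N.toSubmodule.injective_subtype
    N.toSubmodule.injective_subtype

/-- The comultiplication of a subcoalgebra `N`: the restriction of that of `C`, with values in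
`N ⊗ N`, which is a subspace of `C ⊗ C`. -/
def comulRestrict (N : Subcoalgebra K C) : N →ₗ[K] N ⊗[K] N :=
  (LinearEquiv.ofInjective _ N.map_subtype_injective).symm.toLinearMap ∘ₗ
    (Coalgebra.comul ∘ₗ N.toSubmodule.subtype).codRestrict _ (fun c => N.comul_mem' c c.2)

theorem map_subtype_comulRestrict (N : Subcoalgebra K C) :
    TensorProduct.map N.toSubmodule.subtype N.toSubmodule.subtype ∘ₗ N.comulRestrict =
      Coalgebra.comul ∘ₗ N.toSubmodule.subtype := by
  ext c
  have := LinearEquiv.apply_symm_apply (LinearEquiv.ofInjective _ N.map_subtype_injective)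
    ((Coalgebra.comul ∘ₗ N.toSubmodule.subtype).codRestrict _ (fun c => N.comul_mem' c c.2) c)
  exact congrArg Subtype.val this

instance (N : Subcoalgebra K C) : CoalgebraStruct K N where
  comul := N.comulRestrict
  counit := Coalgebra.counit ∘ₗ N.toSubmodule.subtype

/-- A subcoalgebra is a coalgebra with the restricted comultiplication and counit. -/
instance (N : Subcoalgebra K C) : Coalgebra K N where
  coassoc := by
    have hj := N.map_subtype_comulRestrict
    have hinj : Function.Injective (TensorProduct.map N.toSubmodule.subtype
        (TensorProduct.map N.toSubmodule.subtype N.toSubmodule.subtype)) :=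
      TensorProduct.map_injective_of_flat_flat _ _ N.toSubmodule.injective_subtype
        N.map_subtype_injective
    change (TensorProduct.assoc K N N N).toLinearMap ∘ₗ N.comulRestrict.rTensor N ∘ₗ
      N.comulRestrict = N.comulRestrict.lTensor N ∘ₗ N.comulRestrict
    rw [← LinearMap.cancel_left hinj]
    calc _ = (TensorProduct.assoc K C C C).toLinearMap ∘ₗ Coalgebra.comul.rTensor C ∘ₗ
            TensorProduct.map N.toSubmodule.subtype N.toSubmodule.subtype ∘ₗ N.comulRestrict := by
          rw [← LinearMap.comp_assoc N.comulRestrict (TensorProduct.map _ _),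
            LinearMap.rTensor_comp_map, ← hj, ← LinearMap.map_comp_rTensor]
          simp only [← LinearMap.comp_assoc, TensorProduct.map_map_comp_assoc_eq]
      _ = Coalgebra.comul.lTensor C ∘ₗ
            TensorProduct.map N.toSubmodule.subtype N.toSubmodule.subtype ∘ₗ N.comulRestrict := by
          rw [hj]
          simp only [← LinearMap.comp_assoc]
          congr 1
          simp only [LinearMap.comp_assoc]
          exact Coalgebra.coassoc
      _ = _ := by
          rw [← LinearMap.comp_assoc, LinearMap.lTensor_comp_map, ← hj,
            ← LinearMap.map_comp_lTensor, LinearMap.comp_assoc]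
  rTensor_counit_comp_comul := by
    have hj := N.map_subtype_comulRestrict
    have hinj : Function.Injective (N.toSubmodule.subtype.lTensor K) :=
      Module.Flat.lTensor_preserves_injective_linearMap _ N.toSubmodule.injective_subtype
    change (Coalgebra.counit ∘ₗ N.toSubmodule.subtype).rTensor N ∘ₗ N.comulRestrict = _
    rw [← LinearMap.cancel_left hinj, ← LinearMap.comp_assoc, LinearMap.lTensor_comp_rTensor,
      ← LinearMap.rTensor_comp_map, LinearMap.comp_assoc, hj, ← LinearMap.comp_assoc,
      Coalgebra.rTensor_counit_comp_comul]
    rfl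
  lTensor_counit_comp_comul := by
    have hj := N.map_subtype_comulRestrict
    have hinj : Function.Injective (N.toSubmodule.subtype.rTensor K) :=
      Module.Flat.rTensor_preserves_injective_linearMap _ N.toSubmodule.injective_subtype
    change (Coalgebra.counit ∘ₗ N.toSubmodule.subtype).lTensor N ∘ₗ N.comulRestrict = _
    rw [← LinearMap.cancel_left hinj, ← LinearMap.comp_assoc, LinearMap.rTensor_comp_lTensor,
      ← LinearMap.lTensor_comp_map, LinearMap.comp_assoc, hj, ← LinearMap.comp_assoc,
      Coalgebra.lTensor_counit_comp_comul]
    rfl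

end Subcoalgebra

end Subcoalgebra

section Incidence

/-- The incidence coalgebra `KX` of a locally finite partially ordered set `X`: the vector space
with basis the pairs `(x, y)` with `x ≤ y`. -/
def IncidenceCoalgebra (K : Type u) (X : Type v) [Field K] [PartialOrder X] : Type (max u v) :=
  {p : X × X // p.1 ≤ p.2} →₀ K

namespace IncidenceCoalgebra

variable (K : Type u) (X : Type v) [Field K] [PartialOrder X]

instance : AddCommGroup (IncidenceCoalgebra K X) :=
  inferInstanceAs (AddCommGroup ({p : X × X // p.1 ≤ p.2} →₀ K))

instance : Module K (IncidenceCoalgebra K X) :=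
  inferInstanceAs (Module K ({p : X × X // p.1 ≤ p.2} →₀ K))

/-- The basis `e_{x,y}`, `x ≤ y`, of the incidence coalgebra. -/
def basis : Module.Basis {p : X × X // p.1 ≤ p.2} K (IncidenceCoalgebra K X) :=
  .ofRepr (LinearEquiv.refl K ({p : X × X // p.1 ≤ p.2} →₀ K))

variable {X}

open Classical in
/-- The basis element `e_{x,y}` if `x ≤ y`, and `0` otherwise. -/
def e (x y : X) : IncidenceCoalgebra K X := if h : x ≤ y then basis K X ⟨(x, y), h⟩ else 0

theorem basis_eq_e (p : {p : X × X // p.1 ≤ p.2}) : basis K X p = e K p.1.1 p.1.2 := by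
  rw [e, dif_pos p.2]

variable (X)
variable [LocallyFiniteOrder X]

open Classical in
/-- `Δ(e_{x,y}) = ∑_{x ≤ z ≤ y} e_{x,z} ⊗ e_{z,y}` and `ε(e_{x,y}) = δ_{x,y}`. -/
instance : CoalgebraStruct K (IncidenceCoalgebra K X) where
  comul := (basis K X).constr K fun p => ∑ z ∈ Finset.Icc p.1.1 p.1.2, e K p.1.1 z ⊗ₜ e K z p.1.2
  counit := (basis K X).constr K fun p => if p.1.1 = p.1.2 then 1 else 0

theorem comul_e (x y : X) : Coalgebra.comul (R := K) (e K x y) =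
    ∑ z ∈ Finset.Icc x y, e K x z ⊗ₜ[K] e K z y := by
  by_cases h : x ≤ y
  · rw [e, dif_pos h]
    exact (basis K X).constr_basis K _ _
  · rw [e, dif_neg h, map_zero, Finset.Icc_eq_empty h, Finset.sum_empty]

open Classical in
theorem counit_e (x y : X) : Coalgebra.counit (R := K) (e K x y) = if x = y then 1 else 0 := by
  by_cases h : x ≤ y
  · rw [e, dif_pos h]
    exact (basis K X).constr_basis K _ _
  · rw [e, dif_neg h, map_zero, if_neg fun h' => h h'.le]

instance : Coalgebra K (IncidenceCoalgebra K X) where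
  coassoc := by
    refine (basis K X).ext fun p => ?_
    simp only [basis_eq_e, LinearMap.comp_apply, comul_e, map_sum, LinearMap.rTensor_tmul,
      LinearMap.lTensor_tmul, TensorProduct.sum_tmul, TensorProduct.tmul_sum, LinearEquiv.coe_coe,
      TensorProduct.assoc_tmul]
    refine Finset.sum_comm' fun z w => ?_
    simp only [Finset.mem_Icc]
    exact ⟨fun h => ⟨⟨h.2.2, h.1.2⟩, h.2.1, h.2.2.trans h.1.2⟩,
      fun h => ⟨⟨h.2.1.trans h.1.1, h.1.2⟩, h.2.1, h.1.1⟩⟩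
  rTensor_counit_comp_comul := by
    classical
    refine (basis K X).ext fun p => ?_
    simp only [basis_eq_e, LinearMap.comp_apply, comul_e, map_sum, LinearMap.rTensor_tmul,
      counit_e, TensorProduct.mk_apply]
    rw [Finset.sum_eq_single_of_mem p.1.1 (Finset.left_mem_Icc.mpr p.2)]
    · rw [if_pos rfl]
    · intro z _ hz
      rw [if_neg (Ne.symm hz), TensorProduct.zero_tmul]
  lTensor_counit_comp_comul := by
    classical
    refine (basis K X).ext fun p => ?_
    simp only [basis_eq_e, LinearMap.comp_apply, comul_e, map_sum, LinearMap.lTensor_tmul,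
      counit_e, LinearMap.flip_apply, TensorProduct.mk_apply]
    rw [Finset.sum_eq_single_of_mem p.1.2 (Finset.right_mem_Icc.mpr p.2)]
    · rw [if_pos rfl]
    · intro z _ hz
      rw [if_neg hz, TensorProduct.tmul_zero]

end IncidenceCoalgebra

end Incidence

end

open scoped TensorProduct

noncomputable section

/-! Write `C^*` for the dual algebra and let `φ` be a functional on `(C ⊗ D)^*` that vanishes on a
two-sided ideal `I` of finite codimension. Pulled back along `f ↦ f ⊗ ε`, `I` is cofinite in `C^*`,
so by coreflexivity it contains the annihilator of a finite-dimensional `V`. Any `χ` that agrees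
with `ε` on `V` then satisfies `χ ⊗ ε ≡ 1` mod `I`; likewise some `ε ⊗ ψ ≡ 1`, and the product `r =
χ ⊗ ψ` is `≡ 1`. Hence `φ(g) = φ(r g r)` for all `g`, and `r g r = g ∘ corner r` with `corner r =
corner χ ⊗ corner ψ`. If both corners have finite rank, `φ` depends only on `g` restricted to a
finite-dimensional space, so it is an evaluation (`exists_eval_of_finite_range`,
`IsCoreflexive.tensor`). The incidence structure serves only to supply such `χ`
(`HasFiniteCorners`): take the indicator of the `e_{x,x}` with `x` in a finite set `F`, whose corner
is the projection onto the span of the `e_{x,y}` with `x, y ∈ F`. The property passes to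
subcoalgebras by restriction. -/

namespace DualAlgebra

open Coalgebra WithConv

/-! ### Convolution by a functional as a transposed operator, and its compatibility with tensor
products. -/

section Action

variable {K : Type*} {C : Type*} {D : Type*} [Field K]
  [AddCommGroup C] [Module K C] [Coalgebra K C] [AddCommGroup D] [Module K D] [Coalgebra K D]

/-- The map `c ↦ ∑ f(c₁) c₂`. -/
def convLeft (f : C →ₗ[K] K) : C →ₗ[K] C :=
  (TensorProduct.lid K C).toLinearMap ∘ₗ f.rTensor C ∘ₗ comul

/-- The map `c ↦ ∑ c₁ f(c₂)`. -/
def convRight (f : C →ₗ[K] K) : C →ₗ[K] C :=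
  (TensorProduct.rid K C).toLinearMap ∘ₗ f.lTensor C ∘ₗ comul

/-- The map `c ↦ ∑ f(c₁) c₂ f(c₃)`. -/
def corner (f : C →ₗ[K] K) : C →ₗ[K] C :=
  convRight f ∘ₗ convLeft f

theorem mul_eq_comp_convLeft (f g : DualAlgebra K C) :
    f * g = toConv (g.ofConv ∘ₗ convLeft f.ofConv) := by
  ext c
  simp only [LinearMap.convMul_apply, convLeft, LinearMap.comp_apply, LinearEquiv.coe_coe]
  generalize comul (R := K) c = t
  induction t with
  | zero => simp
  | add s t hs ht => simp only [map_add, hs, ht]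
  | tmul a b => simp

theorem mul_eq_comp_convRight (f g : DualAlgebra K C) :
    f * g = toConv (f.ofConv ∘ₗ convRight g.ofConv) := by
  ext c
  simp only [LinearMap.convMul_apply, convRight, LinearMap.comp_apply, LinearEquiv.coe_coe]
  generalize comul (R := K) c = t
  induction t with
  | zero => simp
  | add s t hs ht => simp only [map_add, hs, ht]
  | tmul a b => simp [mul_comm]

/-- Multiplication by `f` on either side is the transpose of an operator on `C`; this turns a rank
condition on `corner` into finiteness of `g ↦ f g f`. -/
theorem mul_mul_eq_comp_corner (f g : DualAlgebra K C) :
    f * (g * f) = toConv (g.ofConv ∘ₗ corner f.ofConv) := by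
  rw [mul_eq_comp_convLeft, mul_eq_comp_convRight g f]
  rfl

/-- The functional `c ⊗ d ↦ f(c) g(d)`. -/
def tensor (f : DualAlgebra K C) (g : DualAlgebra K D) : DualAlgebra K (C ⊗[K] D) :=
  toConv (LinearMap.mul' K K ∘ₗ TensorProduct.map f.ofConv g.ofConv)

/-- The multiplication `K ⊗ K → K` is an algebra homomorphism, so composing with it respects
convolution. -/
theorem tensor_mul_tensor (f h : DualAlgebra K C) (g k : DualAlgebra K D) :
    tensor f g * tensor h k = tensor (f * h) (g * k) := by
  have h₁ := LinearMap.algHom_comp_convMul_distrib (Algebra.TensorProduct.lmul' (S := K) K)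
    (toConv (TensorProduct.map f.ofConv g.ofConv)) (toConv (TensorProduct.map h.ofConv k.ofConv))
  rw [TensorProduct.map_convMul_map] at h₁
  exact (WithConv.ext h₁).symm

theorem one_tensor_one : tensor (1 : DualAlgebra K C) (1 : DualAlgebra K D) = 1 := by
  apply WithConv.ext
  ext c d
  simp [tensor, LinearMap.convOne_def, mul_comm]

theorem convLeft_tensor (f : DualAlgebra K C) (g : DualAlgebra K D) :
    convLeft (tensor f g).ofConv =
      TensorProduct.map (convLeft f.ofConv) (convLeft g.ofConv) := by
  ext c d
  simp only [convLeft, TensorProduct.AlgebraTensorModule.curry_apply,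
    LinearMap.restrictScalars_self, TensorProduct.curry_apply, LinearMap.comp_apply,
    LinearEquiv.coe_coe, TensorProduct.comul_tmul, TensorProduct.map_tmul]
  -- Both sides are bilinear in `Δ c` and `Δ d`, so these may be replaced by arbitrary tensors and
  -- then by pure ones.
  generalize comul (R := K) c = s
  generalize comul (R := K) d = t
  induction s with
  | zero => simp
  | add s s' hs hs' => simp only [map_add, TensorProduct.add_tmul, hs, hs']
  | tmul a b =>
    induction t with
    | zero => simp
    | add s s' hs hs' => simp only [map_add, TensorProduct.tmul_add, hs, hs']
    | tmul a' b' =>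
      simp [tensor]
      rw [← TensorProduct.smul_tmul', smul_smul, mul_comm]

theorem convRight_tensor (f : DualAlgebra K C) (g : DualAlgebra K D) :
    convRight (tensor f g).ofConv =
      TensorProduct.map (convRight f.ofConv) (convRight g.ofConv) := by
  ext c d
  simp only [convRight, TensorProduct.AlgebraTensorModule.curry_apply,
    LinearMap.restrictScalars_self, TensorProduct.curry_apply, LinearMap.comp_apply,
    LinearEquiv.coe_coe, TensorProduct.comul_tmul, TensorProduct.map_tmul]
  generalize comul (R := K) c = s
  generalize comul (R := K) d = t
  induction s with
  | zero => simp
  | add s s' hs hs' => simp only [map_add, TensorProduct.add_tmul, hs, hs']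
  | tmul a b =>
    induction t with
    | zero => simp
    | add s s' hs hs' => simp only [map_add, TensorProduct.tmul_add, hs, hs']
    | tmul a' b' =>
      simp [tensor]
      rw [← TensorProduct.smul_tmul', smul_smul, mul_comm]

theorem corner_tensor (f : DualAlgebra K C) (g : DualAlgebra K D) :
    corner (tensor f g).ofConv = TensorProduct.map (corner f.ofConv) (corner g.ofConv) := by
  rw [corner, convLeft_tensor, convRight_tensor, ← TensorProduct.map_comp]
  rfl

variable (K C D) in
/-- The algebra homomorphism `f ↦ f ⊗ ε`. -/
def inclLeft : DualAlgebra K C →ₐ[K] DualAlgebra K (C ⊗[K] D) :=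
  AlgHom.ofLinearMap
    { toFun f := tensor f 1
      map_add' f g := by simp [tensor, TensorProduct.map_add_left, LinearMap.comp_add]
      map_smul' k f := by simp [tensor, TensorProduct.map_smul_left, LinearMap.comp_smul] }
    one_tensor_one fun f g => by
      change tensor (f * g) 1 = tensor f 1 * tensor g 1
      rw [tensor_mul_tensor, one_mul]

variable (K C D) in
/-- The algebra homomorphism `g ↦ ε ⊗ g`. -/
def inclRight : DualAlgebra K D →ₐ[K] DualAlgebra K (C ⊗[K] D) :=
  AlgHom.ofLinearMap
    { toFun f := tensor 1 f
      map_add' f g := by simp [tensor, TensorProduct.map_add_right, LinearMap.comp_add]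
      map_smul' k f := by simp [tensor, TensorProduct.map_smul_right, LinearMap.comp_smul] }
    one_tensor_one fun f g => by
      change tensor 1 (f * g) = tensor 1 f * tensor 1 g
      rw [tensor_mul_tensor, one_mul]

theorem inclLeft_mul_inclRight (f : DualAlgebra K C) (g : DualAlgebra K D) :
    inclLeft K C D f * inclRight K C D g = tensor f g := by
  change tensor f 1 * tensor 1 g = _
  rw [tensor_mul_tensor, one_mul, mul_one]

end Action

end DualAlgebra

/-- The quotient by the preimage embeds linearly in `B ⧸ I`. -/
theorem Ideal.finite_quotient_comap {K A B : Type*} [Field K] [Ring A] [Algebra K A] [Ring B]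
    [Algebra K B] (φ : A →ₐ[K] B) (I : Ideal B) [Module.Finite K (B ⧸ I)] :
    Module.Finite K (A ⧸ I.comap φ) := by
  let ψ : A →ₗ[K] B ⧸ I := (Submodule.mkQ I).restrictScalars K ∘ₗ φ.toLinearMap
  have hker : LinearMap.ker ψ = (I.comap φ : Submodule A A).restrictScalars K := by
    ext a
    simp [ψ]
  have h : Module.Finite K (A ⧸ LinearMap.ker ψ) := Module.Finite.equiv ψ.quotKerEquivRange.symm
  rw [hker] at h
  exact h

/-! ### Tensor products of coreflexive coalgebras with finite corners. -/

section Coreflexive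

open DualAlgebra WithConv

variable {K : Type*} {C : Type*} {D : Type*} [Field K]
  [AddCommGroup C] [Module K C] [Coalgebra K C] [AddCommGroup D] [Module K D] [Coalgebra K D]

/-- Linear functionals separate points over a field; coreflexivity is therefore a question of
surjectivity. -/
theorem toFiniteDual_injective : Function.Injective (toFiniteDual K C) := by
  intro c d h
  rw [← sub_eq_zero, ← Module.forall_dual_apply_eq_zero_iff K]
  intro f
  have h' : evalDual K C c (toConv f) = evalDual K C d (toConv f) :=
    congrArg (fun t : finiteDual K (DualAlgebra K C) => t.1 (toConv f)) h
  rw [map_sub, sub_eq_zero]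
  exact h'

/-- In the dual of a coreflexive coalgebra, every two-sided ideal of finite codimension contains
the annihilator of a finite-dimensional subspace. -/
theorem IsCoreflexive.exists_forall_mem (hC : IsCoreflexive K C) (I : Ideal (DualAlgebra K C))
    (hI : I.IsTwoSided) [Module.Finite K (DualAlgebra K C ⧸ I)] :
    ∃ V : Submodule K C, Module.Finite K V ∧
      ∀ f : DualAlgebra K C, (∀ c ∈ V, f c = 0) → f ∈ I := by
  let π : DualAlgebra K C →ₗ[K] DualAlgebra K C ⧸ I := (Submodule.mkQ I).restrictScalars K
  have key (l : Module.Dual K (DualAlgebra K C ⧸ I)) :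
      ∃ c : C, ∀ f : DualAlgebra K C, f c = l (π f) := by
    obtain ⟨c, hc⟩ := hC.2 ⟨l ∘ₗ π, I, hI, inferInstance, fun a ha => by
      have : π a = 0 := (Submodule.Quotient.mk_eq_zero I).mpr ha
      rw [LinearMap.comp_apply, this, map_zero]⟩
    exact ⟨c, fun f => congrArg (fun t : finiteDual K (DualAlgebra K C) => t.1 f) hc⟩
  choose c hc using key
  -- The finitely many elements representing the coordinate functionals span `V`: an `f` killing
  -- them has zero class in the quotient.
  let b := Module.finBasis K (DualAlgebra K C ⧸ I)
  refine ⟨Submodule.span K (Set.range fun i => c (b.coord i)),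
    .span_of_finite K (Set.finite_range _), fun f hf => ?_⟩
  have : π f = 0 := b.forall_coord_eq_zero_iff.mp fun i => by
    rw [← hc]
    exact hf _ (Submodule.subset_span ⟨i, rfl⟩)
  exact (Submodule.Quotient.mk_eq_zero I).mp this

/-- A coalgebra has finite corners if for every finite-dimensional subspace `V` there is a
functional `χ` that agrees with the counit on `V` and for which `c ↦ ∑ χ(c₁) c₂ χ(c₃)` has finite
rank. -/
def HasFiniteCorners (K : Type*) (C : Type*) [Field K] [AddCommGroup C] [Module K C]
    [Coalgebra K C] : Prop :=
  ∀ V : Submodule K C, Module.Finite K V → ∃ χ : C →ₗ[K] K,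
    (∀ c ∈ V, χ c = Coalgebra.counit c) ∧ Module.Finite K (LinearMap.range (corner χ))

/-- A functional on the dual algebra that only depends on `g ∘ T`, with `T` of finite rank, is the
evaluation at an element. -/
theorem exists_eval_of_finite_range (φ : Module.Dual K (DualAlgebra K C)) (T : C →ₗ[K] C)
    [Module.Finite K (LinearMap.range T)]
    (h : ∀ g : DualAlgebra K C, φ g = φ (toConv (g.ofConv ∘ₗ T))) :
    ∃ c : C, ∀ g : DualAlgebra K C, g c = φ g := by
  let b := Module.finBasis K (LinearMap.range T)
  -- Expanding `T` in the basis gives `g ∘ T = ∑ g(b i) • (b.coord i ∘ T)`; applying `φ` shows which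
  -- element must represent it.
  refine ⟨∑ i, φ (toConv (b.coord i ∘ₗ T.rangeRestrict)) • (b i : C), fun g => ?_⟩
  have hg : toConv (g.ofConv ∘ₗ T) =
      ∑ i, g (b i : C) • (toConv (b.coord i ∘ₗ T.rangeRestrict) : DualAlgebra K C) := by
    apply WithConv.ext
    ext c
    have hT : T c = ∑ i, b.coord i (T.rangeRestrict c) • (b i : C) := by
      have := congrArg (LinearMap.range T).subtype (b.sum_repr (T.rangeRestrict c))
      rw [map_sum] at this
      exact this.symm
    rw [ofConv_sum]
    simp only [LinearMap.comp_apply, hT, map_sum, map_smul, LinearMap.sum_apply,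
      ofConv_smul, LinearMap.smul_apply, smul_eq_mul, mul_comm]
  rw [h, hg]
  simp only [map_sum, map_smul, smul_eq_mul, mul_comm]

/-- A `χ` agreeing with the counit on `V` makes `1 - χ` annihilate `V`, and the preimage of `I`
contains that annihilator. -/
theorem HasFiniteCorners.exists_one_sub_mem (hC : HasFiniteCorners K C) (hC' : IsCoreflexive K C)
    {A : Type*} [Ring A] [Algebra K A] (j : DualAlgebra K C →ₐ[K] A) (I : Ideal A)
    (hI : I.IsTwoSided) [Module.Finite K (A ⧸ I)] :
    ∃ χ : DualAlgebra K C, 1 - j χ ∈ I ∧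
      Module.Finite K (LinearMap.range (corner χ.ofConv)) := by
  have := Ideal.finite_quotient_comap j I
  obtain ⟨V, hV, hVI⟩ := hC'.exists_forall_mem (I.comap j) inferInstance
  obtain ⟨χ, hχ, hfin⟩ := hC V hV
  refine ⟨toConv χ, ?_, hfin⟩
  have := hVI (1 - toConv χ) fun c hc => by
    simp [LinearMap.convOne_def, hχ c hc]
  simpa using this

theorem IsCoreflexive.tensor (hC : IsCoreflexive K C) (hD : IsCoreflexive K D)
    (hC' : HasFiniteCorners K C) (hD' : HasFiniteCorners K D) :
    IsCoreflexive K (C ⊗[K] D) := by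
  refine ⟨toFiniteDual_injective, ?_⟩
  rintro ⟨φ, I, hI, hfin, hφ⟩
  obtain ⟨χ, hχ, hχf⟩ := hC'.exists_one_sub_mem hC (inclLeft K C D) I hI
  obtain ⟨ψ, hψ, hψf⟩ := hD'.exists_one_sub_mem hD (inclRight K C D) I hI
  -- `1 - χ ⊗ ψ = (1 - χ ⊗ ε) + (χ ⊗ ε)(1 - ε ⊗ ψ)`.
  have hr : 1 - DualAlgebra.tensor χ ψ ∈ I := by
    have := I.add_mem hχ (I.mul_mem_left (inclLeft K C D χ) hψ)
    rwa [mul_sub, mul_one, inclLeft_mul_inclRight, sub_add_sub_cancel] at this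
  generalize hrdef : DualAlgebra.tensor χ ψ = r at hr
  have hT : Module.Finite K (LinearMap.range (corner r.ofConv)) := by
    rw [← hrdef, corner_tensor]
    -- The range lies in the image of the tensor product of the two finite-dimensional ranges.
    have hle : LinearMap.range (TensorProduct.map (corner χ.ofConv) (corner ψ.ofConv)) ≤
        LinearMap.range (TensorProduct.map (LinearMap.range (corner χ.ofConv)).subtype
          (LinearMap.range (corner ψ.ofConv)).subtype) := by
      rintro _ ⟨t, rfl⟩
      refine ⟨TensorProduct.map (corner χ.ofConv).rangeRestrict
        (corner ψ.ofConv).rangeRestrict t, ?_⟩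
      rw [← LinearMap.comp_apply, ← TensorProduct.map_comp]
      rfl
    exact Submodule.finiteDimensional_of_le hle
  obtain ⟨c, hc⟩ := exists_eval_of_finite_range φ (corner r.ofConv) fun g => by
    rw [← mul_mul_eq_comp_corner, ← sub_eq_zero, ← map_sub]
    apply hφ
    have : g - r * (g * r) = (1 - r) * g + r * (g * (1 - r)) := by
      simp only [sub_mul, mul_sub, one_mul, mul_one]
      abel
    rw [this]
    exact I.add_mem (hI.mul_mem_of_left g hr) (I.mul_mem_left _ (I.mul_mem_left _ hr))
  exact ⟨c, Subtype.ext (LinearMap.ext hc)⟩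

end Coreflexive

/-! ### Finite corners for incidence coalgebras and their subcoalgebras. -/

section Incidence

open DualAlgebra

namespace Subcoalgebra

variable {K : Type*} {C : Type*} [Field K] [AddCommGroup C] [Module K C] [Coalgebra K C]

theorem convLeft_restrict (N : Subcoalgebra K C) (f : C →ₗ[K] K) :
    N.toSubmodule.subtype ∘ₗ convLeft (f ∘ₗ N.toSubmodule.subtype) =
      convLeft f ∘ₗ N.toSubmodule.subtype := by
  have h : N.toSubmodule.subtype ∘ₗ (TensorProduct.lid K N).toLinearMap ∘ₗ
      (f ∘ₗ N.toSubmodule.subtype).rTensor N = (TensorProduct.lid K C).toLinearMap ∘ₗ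
      f.rTensor C ∘ₗ TensorProduct.map N.toSubmodule.subtype N.toSubmodule.subtype := by
    ext a b
    simp
  simp only [convLeft, LinearMap.comp_assoc]
  rw [← map_subtype_comulRestrict]
  exact congrArg (· ∘ₗ N.comulRestrict) h

theorem convRight_restrict (N : Subcoalgebra K C) (f : C →ₗ[K] K) :
    N.toSubmodule.subtype ∘ₗ convRight (f ∘ₗ N.toSubmodule.subtype) =
      convRight f ∘ₗ N.toSubmodule.subtype := by
  have h : N.toSubmodule.subtype ∘ₗ (TensorProduct.rid K N).toLinearMap ∘ₗ
      (f ∘ₗ N.toSubmodule.subtype).lTensor N = (TensorProduct.rid K C).toLinearMap ∘ₗ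
      f.lTensor C ∘ₗ TensorProduct.map N.toSubmodule.subtype N.toSubmodule.subtype := by
    ext a b
    simp
  simp only [convRight, LinearMap.comp_assoc]
  rw [← map_subtype_comulRestrict]
  exact congrArg (· ∘ₗ N.comulRestrict) h

theorem corner_restrict (N : Subcoalgebra K C) (f : C →ₗ[K] K) :
    N.toSubmodule.subtype ∘ₗ corner (f ∘ₗ N.toSubmodule.subtype) =
      corner f ∘ₗ N.toSubmodule.subtype := by
  rw [corner, ← LinearMap.comp_assoc, convRight_restrict, LinearMap.comp_assoc,
    convLeft_restrict]
  rfl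

/-- Restrict to `N` a functional chosen for the image of `V` in `C`: the inclusion intertwines the
two corner maps, so it embeds the range of the new one in the range of the old. -/
theorem hasFiniteCorners (N : Subcoalgebra K C) (h : HasFiniteCorners K C) :
    HasFiniteCorners K N := by
  intro V hV
  obtain ⟨χ, hχ, hfin⟩ := h (V.map N.toSubmodule.subtype) inferInstance
  refine ⟨χ ∘ₗ N.toSubmodule.subtype, fun c hc => hχ c (Submodule.mem_map_of_mem hc), ?_⟩
  have hle : (LinearMap.range (corner (χ ∘ₗ N.toSubmodule.subtype))).map N.toSubmodule.subtype ≤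
      LinearMap.range (corner χ) := by
    rw [← LinearMap.range_comp, corner_restrict]
    exact LinearMap.range_comp_le_range _ _
  have := Submodule.finiteDimensional_of_le hle
  exact Module.Finite.equiv (Submodule.equivMapOfInjective _ N.toSubmodule.injective_subtype _).symm

end Subcoalgebra

namespace IncidenceCoalgebra

variable (K : Type*) {X : Type*} [Field K] [PartialOrder X]

open Classical in
/-- The functional `e_{x,y} ↦ δ_{x,y}` for `x ∈ F`, and `e_{x,y} ↦ 0` for `x ∉ F`. -/
def diagIndicator (F : Finset X) : IncidenceCoalgebra K X →ₗ[K] K :=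
  (basis K X).constr K fun p => if p.1.1 = p.1.2 ∧ p.1.1 ∈ F then 1 else 0

open Classical in
theorem diagIndicator_e (F : Finset X) (x y : X) :
    diagIndicator K F (e K x y) = if x = y ∧ x ∈ F then 1 else 0 := by
  by_cases h : x ≤ y
  · rw [e, dif_pos h]
    exact (basis K X).constr_basis K _ _
  · rw [e, dif_neg h, map_zero, if_neg fun h' => h h'.1.le]

variable [LocallyFiniteOrder X]

-- Only the term `z = x` of `Δ(e_{x,y})` has a diagonal left factor, so the operator keeps or kills
-- `e_{x,y}` according to its left endpoint.
open Classical in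
theorem convLeft_diagIndicator_e (F : Finset X) {x y : X} (h : x ≤ y) :
    convLeft (diagIndicator K F) (e K x y) = if x ∈ F then e K x y else 0 := by
  simp only [convLeft, LinearMap.comp_apply, comul_e, map_sum, LinearMap.rTensor_tmul,
    diagIndicator_e, LinearEquiv.coe_coe, TensorProduct.lid_tmul]
  rw [Finset.sum_eq_single_of_mem x (Finset.left_mem_Icc.mpr h)]
  · simp
  · intro z _ hz
    rw [if_neg fun h' => hz h'.1.symm, zero_smul]

open Classical in
theorem convRight_diagIndicator_e (F : Finset X) {x y : X} (h : x ≤ y) :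
    convRight (diagIndicator K F) (e K x y) = if y ∈ F then e K x y else 0 := by
  simp only [convRight, LinearMap.comp_apply, comul_e, map_sum, LinearMap.lTensor_tmul,
    diagIndicator_e, LinearEquiv.coe_coe, TensorProduct.rid_tmul]
  rw [Finset.sum_eq_single_of_mem y (Finset.right_mem_Icc.mpr h)]
  · simp
  · intro z _ hz
    rw [if_neg fun h' => hz h'.1, zero_smul]

theorem finite_range_corner_diagIndicator (F : Finset X) :
    Module.Finite K (LinearMap.range (corner (diagIndicator K F))) := by
  classical
  have hfin : Module.Finite K (Submodule.span K
      ((fun p : X × X => e K p.1 p.2) '' (F ×ˢ F : Finset (X × X)))) :=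
    .span_of_finite K ((F ×ˢ F).finite_toSet.image _)
  refine Submodule.finiteDimensional_of_le (S₂ := Submodule.span K
      ((fun p : X × X => e K p.1 p.2) '' (F ×ˢ F : Finset (X × X)))) ?_
  rw [LinearMap.range_eq_map, ← (basis K X).span_eq, Submodule.map_span, Submodule.span_le]
  rintro _ ⟨_, ⟨p, rfl⟩, rfl⟩
  rw [basis_eq_e, corner, LinearMap.comp_apply, convLeft_diagIndicator_e K F p.2]
  split_ifs with hx
  · rw [convRight_diagIndicator_e K F p.2]
    split_ifs with hy
    · exact Submodule.subset_span ⟨p.1, by simp [hx, hy], rfl⟩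
    · exact Submodule.zero_mem _
  · rw [map_zero]
    exact Submodule.zero_mem _

variable (X) in
theorem hasFiniteCorners : HasFiniteCorners K (IncidenceCoalgebra K X) := by
  classical
  intro V hV
  obtain ⟨S, rfl⟩ := Module.Finite.iff_fg.mp hV
  -- Left endpoints suffice: the indicator and the counit both vanish off the diagonal, where the
  -- endpoints differ.
  let F : Finset X := S.biUnion fun c => ((basis K X).repr c).support.image fun p => p.1.1
  refine ⟨diagIndicator K F, fun c hc => ?_, finite_range_corner_diagIndicator K F⟩
  suffices h : Submodule.span K (S : Set (IncidenceCoalgebra K X)) ≤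
      LinearMap.eqLocus (diagIndicator K F) Coalgebra.counit from h hc
  rw [Submodule.span_le]
  intro c hc
  change diagIndicator K F c = Coalgebra.counit c
  rw [← (basis K X).linearCombination_repr c, Finsupp.linearCombination_apply, Finsupp.sum,
    map_sum, map_sum]
  refine Finset.sum_congr rfl fun p hp => ?_
  have hpF : p.1.1 ∈ F :=
    Finset.mem_biUnion.mpr ⟨c, hc, Finset.mem_image_of_mem (fun p => p.1.1) hp⟩
  rw [map_smul, map_smul, basis_eq_e, diagIndicator_e, counit_e]
  simp [hpF]

end IncidenceCoalgebra

end Incidence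

end

theorem corollary5p12 {K : Type*} [Field K]
    {X : Type*} [PartialOrder X] [LocallyFiniteOrder X]
    {Y : Type*} [PartialOrder Y] [LocallyFiniteOrder Y]
    (C : Subcoalgebra K (IncidenceCoalgebra K X)) (D : Subcoalgebra K (IncidenceCoalgebra K Y))
    (hC : IsCoreflexive K C) (hD : IsCoreflexive K D) :
    IsCoreflexive K (C ⊗[K] D) := by
  exact hC.tensor hD (C.hasFiniteCorners (IncidenceCoalgebra.hasFiniteCorners K X))
    (D.hasFiniteCorners (IncidenceCoalgebra.hasFiniteCorners K Y))
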